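/- Let $\ell_2$ be the real Hilbert space of square-summable sequences. A name of a point $z\in\ell_2$ is a sequence $(q_n)_{n\in\mathbb{N}}$ of (codes of) finite sequences of rational numbers, regarded as elements of $\ell_2$ with finite support, such that $\lVert q_n-q_m\rVert<2^{-n}$ for all $m>n$ and $q_n\to z$ in norm. A sequence $(x_i)_{i\in\mathbb{N}}$ in $\ell_2$ is computable if there is a computable double sequence $(q_{i,n})_{i,n}$ such that $(q_{i,n})_n$ is a name of $x_i$ for every $i$. A point $z$ is a weak cluster point of $(x_i)_i$ if some subsequence of $(x_i)_i$ converges weakly to $z$. Then there is a computable, norm-bounded sequence $(x_i)_{i\in\mathbb{N}}$ in $\ell_2$ such that every weak cluster point $z$ of $(x_i)_i$ computes the second Turing jump $0''$ of the empty set, i.e. $0''$ is Turing reducible to every name of $z$. -/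

import Mathlib

namespace WeakBW

/-! ### Oracle programs and the Turing jump -/

/-- Programs for the functions that are partial recursive relative to an oracle; one constructor
for each clause of `Nat.RecursiveIn`. -/
inductive OracleCode : Type
  | zero : OracleCode
  | succ : OracleCode
  | left : OracleCode
  | right : OracleCode
  | oracle : OracleCode
  | pair : OracleCode → OracleCode → OracleCode
  | comp : OracleCode → OracleCode → OracleCode
  | prec : OracleCode → OracleCode → OracleCode
  | rfind : OracleCode → OracleCode

namespace OracleCode

/-- The partial function computed by a program with the oracle `g`. -/
def eval (g : ℕ →. ℕ) : OracleCode → ℕ →. ℕ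
  | zero => fun _ => Part.some 0
  | succ => fun n => Part.some (n + 1)
  | left => fun n => Part.some n.unpair.1
  | right => fun n => Part.some n.unpair.2
  | oracle => g
  | pair a b => fun n => Nat.pair <$> eval g a n <*> eval g b n
  | comp a b => fun n => eval g b n >>= eval g a
  | prec a b => fun p =>
      Nat.rec (eval g a p.unpair.1)
        (fun y IH => IH >>= fun i => eval g b (Nat.pair p.unpair.1 (Nat.pair y i))) p.unpair.2
  | rfind a => fun p => Nat.rfind fun n => (fun m => decide (m = 0)) <$> eval g a (Nat.pair p n)

/-- The Gödel numbering: `ofNat e` is the program with index `e`. It follows the numbering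
`Nat.Partrec.Code.ofNatCode` of programs without oracle, with one more basic program. -/
def ofNat : ℕ → OracleCode
  | 0 => zero
  | 1 => succ
  | 2 => left
  | 3 => right
  | 4 => oracle
  | n + 5 =>
    have hm : n / 4 < n + 5 := lt_of_le_of_lt (Nat.div_le_self n 4) (by omega)
    have _h1 : (n / 4).unpair.1 < n + 5 := lt_of_le_of_lt (Nat.unpair_left_le _) hm
    have _h2 : (n / 4).unpair.2 < n + 5 := lt_of_le_of_lt (Nat.unpair_right_le _) hm
    match n % 4 with
    | 0 => pair (ofNat (n / 4).unpair.1) (ofNat (n / 4).unpair.2)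
    | 1 => comp (ofNat (n / 4).unpair.1) (ofNat (n / 4).unpair.2)
    | 2 => prec (ofNat (n / 4).unpair.1) (ofNat (n / 4).unpair.2)
    | _ => rfind (ofNat (n / 4))

end OracleCode

open Classical in
/-- The characteristic function of a set of natural numbers. -/
noncomputable def charFn (A : Set ℕ) (n : ℕ) : ℕ := if n ∈ A then 1 else 0

/-- The Turing jump `A'`: the set of all `e` such that the program with index `e`, run with oracle
`A` on the input `e`, halts. -/
def jump (A : Set ℕ) : Set ℕ :=
  {e | ((OracleCode.ofNat e).eval (fun n => Part.some (charFn A n)) e).Dom}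

/-- The second Turing jump `0''`. -/
def zeroDoubleJump : Set ℕ := jump (jump ∅)

/-! ### The space `ℓ₂` and its names -/

/-- The real Hilbert space `ℓ₂`. -/
abbrev Ell2 : Type := lp (fun _ : ℕ => ℝ) 2

/-- `(a, b, c)` is a code of the rational number `(a - b) / (c + 1)`. -/
abbrev RatCode : Type := ℕ × ℕ × ℕ

/-- The rational number with a given code. -/
def RatCode.toRat (r : RatCode) : ℚ := ((r.1 : ℚ) - (r.2.1 : ℚ)) / ((r.2.2 : ℚ) + 1)

/-- The element `⟨r₀, …, r_m, 0, 0, …⟩` of `ℓ₂` with rational coordinates `r₀, …, r_m`. -/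
noncomputable def ratVec (l : List RatCode) : Ell2 :=
  ∑ k ∈ Finset.range l.length, lp.single 2 k ((RatCode.toRat (l.getD k (0, 0, 0)) : ℚ) : ℝ)

/-- `p` is a name of `x`: a sequence of (codes of) finite rational sequences that converges to `x`
in norm, with `‖p n - p m‖ < 2⁻ⁿ` for all `m > n`. -/
def IsName (p : ℕ → List RatCode) (x : Ell2) : Prop :=
  (∀ n m : ℕ, n < m → ‖ratVec (p n) - ratVec (p m)‖ < (1 / 2 : ℝ) ^ n) ∧
    Filter.Tendsto (fun n => ratVec (p n)) Filter.atTop (nhds x)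

/-- A sequence in `ℓ₂` is computable if names of its members can be computed uniformly. -/
def ComputableSeq (x : ℕ → Ell2) : Prop :=
  ∃ f : ℕ → ℕ → List RatCode, Computable₂ f ∧ ∀ i, IsName (f i) (x i)

/-- Weak convergence in `ℓ₂`. -/
def WeaklyConverges (x : ℕ → Ell2) (z : Ell2) : Prop :=
  ∀ y : Ell2, Filter.Tendsto (fun i => inner ℝ y (x i)) Filter.atTop (nhds (inner ℝ y z))

/-- `z` is a weak cluster point of `x` if some subsequence of `x` converges weakly to `z`. -/
def IsWeakClusterPt (x : ℕ → Ell2) (z : Ell2) : Prop :=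
  ∃ s : ℕ → ℕ, StrictMono s ∧ WeaklyConverges (fun i => x (s i)) z

/-- The point `z` computes the set `A`: `A` is Turing reducible to every name of `z`. -/
def PointComputes (z : Ell2) (A : Set ℕ) : Prop :=
  ∀ p : ℕ → List RatCode, IsName p z →
    TuringReducible (fun n => Part.some (charFn A n)) (fun n => Part.some (Encodable.encode (p n)))

end WeakBW

/-!
The second jump is a `Σ₂` set: a computation with the oracle `0'` halts if and only if it halts with
an approximation of `0'` at some finite stage that is never revised on the questions asked.

For a `Σ₂` set `A` there is a primitive recursive `f` such that `i ↦ f e i` is eventually constant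
for `e ∈ A` and diverges to infinity for `e ∉ A`. Let `x i` have the entry `2⁻ᵉ` at the positions
`⟨e, f e i⟩`, and `0` elsewhere. If `e ∈ A`, the peak in the block of coordinates `⟨e, ·⟩` comes to
rest and survives in every weak limit; if `e ∉ A`, it escapes to infinity and the block of the limit
vanishes. The two cases are told apart by an approximation of the limit with error `2⁻ᵉ / 4`.
-/

namespace WeakBW

open Filter Topology
open Nat.Partrec (Code)

namespace OracleCode

/-! ### The use of an oracle computation -/

section

variable {g : ℕ →. ℕ} {a b : OracleCode} {n k y : ℕ}

theorem mem_eval_pair :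
    y ∈ (pair a b).eval g n ↔ ∃ v ∈ a.eval g n, ∃ w ∈ b.eval g n, Nat.pair v w = y := by
  simp only [eval, Seq.seq, Part.map_eq_map, Part.bind_map, Part.mem_bind_iff, Part.mem_map_iff]

theorem mem_eval_comp : y ∈ (comp a b).eval g n ↔ ∃ v ∈ b.eval g n, y ∈ a.eval g v :=
  Part.mem_bind_iff

theorem mem_eval_prec_zero : y ∈ (prec a b).eval g (Nat.pair n 0) ↔ y ∈ a.eval g n := by
  simp [eval]

theorem mem_eval_prec_succ :
    y ∈ (prec a b).eval g (Nat.pair n (k + 1)) ↔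
      ∃ v ∈ (prec a b).eval g (Nat.pair n k), y ∈ b.eval g (Nat.pair n (Nat.pair k v)) := by
  simp [eval]

theorem mem_eval_rfind :
    y ∈ (rfind a).eval g n ↔
      0 ∈ a.eval g (Nat.pair n y) ∧ ∀ m < y, ∃ v ∈ a.eval g (Nat.pair n m), v ≠ 0 :=
  Nat.mem_rfind.trans (by simp)

end

/-- A halting computation asks only finitely many questions, so it halts with every oracle that is
close enough to the given one. -/
theorem eventually_mem_eval {ι : Type*} {l : Filter ι} {g : ℕ →. ℕ} {h : ι → ℕ →. ℕ}
    (hgh : ∀ n, ∀ y ∈ g n, ∀ᶠ i in l, y ∈ h i n) (c : OracleCode) :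
    ∀ n, ∀ y ∈ c.eval g n, ∀ᶠ i in l, y ∈ c.eval (h i) n := by
  induction c with
  | zero | succ | left | right => exact fun _ _ hy => .of_forall fun _ => hy
  | oracle => exact hgh
  | pair a b iha ihb =>
    intro n y hy
    obtain ⟨v, hv, w, hw, rfl⟩ := mem_eval_pair.1 hy
    filter_upwards [iha _ _ hv, ihb _ _ hw] with i hvi hwi
    exact mem_eval_pair.2 ⟨v, hvi, w, hwi, rfl⟩
  | comp a b iha ihb =>
    intro n y hy
    obtain ⟨v, hv, hvy⟩ := mem_eval_comp.1 hy
    filter_upwards [ihb _ _ hv, iha _ _ hvy] with i hvi hvyi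
    exact mem_eval_comp.2 ⟨v, hvi, hvyi⟩
  | prec a b iha ihb =>
    intro p
    obtain ⟨n, k, rfl⟩ : ∃ n k, p = Nat.pair n k := ⟨_, _, (Nat.pair_unpair p).symm⟩
    induction k with
    | zero => simpa only [mem_eval_prec_zero] using iha n
    | succ k ihk =>
      intro y hy
      obtain ⟨v, hv, hvy⟩ := mem_eval_prec_succ.1 hy
      filter_upwards [ihk _ hv, ihb _ _ hvy] with i hvi hvyi
      exact mem_eval_prec_succ.2 ⟨v, hvi, hvyi⟩
  | rfind a iha =>
    intro n y hy
    obtain ⟨hzero, hne⟩ := mem_eval_rfind.1 hy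
    have hne' : ∀ᶠ i in l, ∀ m < y, ∃ v ∈ a.eval (h i) (Nat.pair n m), v ≠ 0 := by
      refine (eventually_all_finite (Set.finite_Iio y)).2 fun m hm => ?_
      obtain ⟨v, hv, hv₀⟩ := hne m hm
      exact (iha _ _ hv).mono fun i hvi => ⟨v, hvi, hv₀⟩
    filter_upwards [iha _ _ hzero, hne'] with i hi hi'
    exact mem_eval_rfind.2 ⟨hi, hi'⟩

theorem eval_mono {g h : ℕ →. ℕ} (hgh : ∀ n, g n ≤ h n) (c : OracleCode) (n : ℕ) :
    c.eval g n ≤ c.eval h n := fun y hy => by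
  simpa using eventually_mem_eval (l := pure ()) (h := fun _ => h)
    (fun n y hy => by simpa using hgh n y hy) c n y hy

/-- The partial function `g` restricted to the arguments below `u`: an oracle that answers only
the questions below `u`. -/
def restrictBelow (g : ℕ →. ℕ) (u : ℕ) : ℕ →. ℕ := fun n => if n < u then g n else Part.none

theorem restrictBelow_le (g : ℕ →. ℕ) (u n : ℕ) : restrictBelow g u n ≤ g n := by
  unfold restrictBelow
  split_ifs
  exacts [le_rfl, bot_le]

theorem restrictBelow_congr {g h : ℕ →. ℕ} {u : ℕ} (hgh : ∀ n < u, g n = h n) :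
    restrictBelow g u = restrictBelow h u := by
  funext n
  exact ite_congr rfl (hgh n) fun _ => rfl

theorem eval_dom_iff_exists_restrictBelow {g : ℕ →. ℕ} {c : OracleCode} {n : ℕ} :
    (c.eval g n).Dom ↔ ∃ u, (c.eval (restrictBelow g u) n).Dom := by
  simp only [Part.dom_iff_mem]
  constructor
  · rintro ⟨y, hy⟩
    have hlim : ∀ n, ∀ y ∈ g n, ∀ᶠ u in atTop, y ∈ restrictBelow g u n := fun n y hy =>
      (eventually_gt_atTop n).mono fun u hu => by rwa [restrictBelow, if_pos hu]
    exact (eventually_mem_eval hlim c n y hy).exists.imp fun u hu => ⟨y, hu⟩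
  · rintro ⟨u, y, hy⟩
    exact ⟨y, eval_mono (restrictBelow_le g u) c n y hy⟩

/-! ### Replacing a partial recursive oracle by a program for it -/

/-- The program without oracle obtained by substituting `b` for the oracle. -/
def toCode (b : Code) : OracleCode → Code
  | zero => .zero
  | succ => .succ
  | left => .left
  | right => .right
  | oracle => b
  | pair c d => .pair (toCode b c) (toCode b d)
  | comp c d => .comp (toCode b c) (toCode b d)
  | prec c d => .prec (toCode b c) (toCode b d)
  | rfind c => .comp (.rfind' (toCode b c)) (.pair Code.id .zero)

theorem eval_toCode (b : Code) (c : OracleCode) : (toCode b c).eval = c.eval b.eval := by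
  induction c with
  | zero | succ | left | right | oracle => rfl
  | pair c d ihc ihd | comp c d ihc ihd =>
    simp only [toCode, Code.eval, eval, ihc, ihd]
    rfl
  | prec c d ihc ihd =>
    funext p
    simp only [toCode, Code.eval, eval, ihc, ihd, Nat.unpaired]
  | rfind c ihc =>
    funext p
    have start : (Code.pair Code.id .zero).eval p = Part.some (Nat.pair p 0) := by
      simp [Code.eval, Seq.seq, pure, PFun.pure]
    calc (toCode b (rfind c)).eval p
        = ((Code.pair Code.id .zero).eval p).bind (Code.rfind' (toCode b c)).eval := rfl
      _ = (Code.rfind' (toCode b c)).eval (Nat.pair p 0) := by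
        rw [start]; exact Part.bind_some _ _
      _ = (rfind c).eval b.eval p := by simp [Code.eval, eval, ihc, Nat.unpaired, Part.map_id']

/-- The step of the course-of-values recursion computing `toCode b (ofNat n)`, where `l` lists the
results for the numbers below `n`. -/
def toCodeStep (b : Code) (l : List Code) : Code :=
  let n := l.length
  let m := (n - 5) / 4
  let c := l.getD m .zero
  let c₁ := l.getD m.unpair.1 .zero
  let c₂ := l.getD m.unpair.2 .zero
  if n = 0 then .zero else if n = 1 then .succ else if n = 2 then .left else
  if n = 3 then .right else if n = 4 then b else
  if (n - 5) % 4 = 0 then .pair c₁ c₂ else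
  if (n - 5) % 4 = 1 then .comp c₁ c₂ else
  if (n - 5) % 4 = 2 then .prec c₁ c₂ else .comp (.rfind' c) (.pair Code.id .zero)

theorem toCodeStep_map_range (b : Code) (n : ℕ) :
    toCodeStep b ((List.range n).map fun k => toCode b (ofNat k)) = toCode b (ofNat n) := by
  have getD_map : ∀ k < n, ((List.range n).map fun k => toCode b (ofNat k)).getD k .zero =
      toCode b (ofNat k) := by
    intro k hk
    simp [List.getD, hk]
  match n, getD_map with
  | 0, _ | 1, _ | 2, _ | 3, _ | 4, _ => simp [toCodeStep, ofNat, toCode]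
  | n + 5, getD_map =>
    have hm : n / 4 < n + 5 := by omega
    simp only [toCodeStep, List.length_map, List.length_range, Nat.add_sub_cancel,
      getD_map _ hm, getD_map _ ((Nat.unpair_left_le _).trans_lt hm),
      getD_map _ ((Nat.unpair_right_le _).trans_lt hm)]
    rw [ofNat]
    have hr : n % 4 < 4 := Nat.mod_lt _ (by norm_num)
    generalize n % 4 = r at hr
    interval_cases r <;> simp [toCode]

theorem primrec_toCodeStep : Primrec₂ toCodeStep := by
  have n : Primrec fun p : Code × List Code => p.2.length := Primrec.list_length.comp .snd
  have n5 : Primrec fun p : Code × List Code => p.2.length - 5 :=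
    Primrec.nat_sub.comp n (.const 5)
  have m : Primrec fun p : Code × List Code => (p.2.length - 5) / 4 :=
    Primrec.nat_div.comp n5 (.const 4)
  have r : Primrec fun p : Code × List Code => (p.2.length - 5) % 4 :=
    Primrec.nat_mod.comp n5 (.const 4)
  have c := (Primrec.list_getD Code.zero).comp (Primrec.snd (α := Code)) m
  have c₁ := (Primrec.list_getD Code.zero).comp (Primrec.snd (α := Code))
    (Primrec.fst.comp (Primrec.unpair.comp m))
  have c₂ := (Primrec.list_getD Code.zero).comp (Primrec.snd (α := Code))
    (Primrec.snd.comp (Primrec.unpair.comp m))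
  exact Primrec.ite (Primrec.eq.comp n (.const 0)) (.const _) <|
    Primrec.ite (Primrec.eq.comp n (.const 1)) (.const _) <|
    Primrec.ite (Primrec.eq.comp n (.const 2)) (.const _) <|
    Primrec.ite (Primrec.eq.comp n (.const 3)) (.const _) <|
    Primrec.ite (Primrec.eq.comp n (.const 4)) .fst <|
    Primrec.ite (Primrec.eq.comp r (.const 0)) (Code.primrec₂_pair.comp c₁ c₂) <|
    Primrec.ite (Primrec.eq.comp r (.const 1)) (Code.primrec₂_comp.comp c₁ c₂) <|
    Primrec.ite (Primrec.eq.comp r (.const 2)) (Code.primrec₂_prec.comp c₁ c₂) <|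
    Code.primrec₂_comp.comp (Code.primrec_rfind'.comp c) (.const _)

theorem primrec_toCode_ofNat : Primrec₂ fun (b : Code) (n : ℕ) => toCode b (ofNat n) :=
  Primrec.nat_strong_rec _ (Primrec.option_some.comp₂ primrec_toCodeStep)
    fun b n => congrArg some (toCodeStep_map_range b n)

end OracleCode

/-! ### Jumps of computable and of recursively enumerable sets -/

open OracleCode

/-- The set `A` as an oracle. -/
noncomputable abbrev charOracle (A : Set ℕ) : ℕ →. ℕ := fun n => Part.some (charFn A n)

/-- A number is enumerated by stage `s` if the program `c` halts on it within `s` steps. -/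
def enumUpTo (c : Code) (s : ℕ) : Set ℕ := {n | (c.evaln s n).isSome}

theorem monotone_enumUpTo (c : Code) : Monotone (enumUpTo c) := by
  intro s t hst n hn
  obtain ⟨y, hy⟩ := Option.isSome_iff_exists.1 hn
  exact Option.isSome_iff_exists.2 ⟨y, Code.evaln_mono hst hy⟩

theorem iUnion_enumUpTo (c : Code) : ⋃ s, enumUpTo c s = {n | (c.eval n).Dom} := by
  ext n
  simp only [enumUpTo, Set.mem_iUnion, Set.mem_ofPred_eq, Option.isSome_iff_exists,
    Part.dom_iff_mem, Code.evaln_complete, Option.mem_def]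
  exact exists_comm

theorem primrecPred_mem_enumUpTo {α : Type*} [Primcodable α] {c : α → Code} {s n : α → ℕ}
    (hc : Primrec c) (hs : Primrec s) (hn : Primrec n) :
    PrimrecPred fun a => n a ∈ enumUpTo (c a) (s a) :=
  Primrec.eq.comp (Primrec.option_isSome.comp (Code.primrec_evaln.comp ((hs.pair hc).pair hn)))
    (.const true)

theorem exists_iUnion_enumUpTo_eq {A : Set ℕ} (hA : REPred (· ∈ A)) :
    ∃ c : Code, ⋃ s, enumUpTo c s = A := by
  obtain ⟨c, hc⟩ := Code.exists_code.1 hA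
  refine ⟨c, ?_⟩
  rw [iUnion_enumUpTo, hc]
  ext n
  simp [Part.assert]

open Classical in
theorem charFn_congr {A B : Set ℕ} {m n : ℕ} (h : m ∈ A ↔ n ∈ B) : charFn A m = charFn B n :=
  if_congr h rfl rfl

theorem computable_charFn {α : Type*} [Primcodable α] {B : α → Set ℕ} {n : α → ℕ}
    (h : ComputablePred fun a => n a ∈ B a) : Computable fun a => charFn (B a) (n a) := by
  classical
  refine (Computable.cond h.decide (.const 1) (.const 0)).of_eq fun a => ?_
  by_cases hn : n a ∈ B a <;> simp [charFn, hn]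

theorem rePred_mem_jump {A : Set ℕ} (hA : ComputablePred (· ∈ A)) : REPred (· ∈ jump A) := by
  obtain ⟨b, hb⟩ := Code.exists_code.1 (Partrec.nat_iff.1 (computable_charFn hA).partrec)
  refine (Code.eval_part.comp (primrec_toCode_ofNat.comp (.const b) .id).to_comp
    Computable.id).dom_re.of_eq fun e => ?_
  rw [eval_toCode, hb]
  rfl

theorem exists_forall_lt_mem_of_monotone {B : ℕ → Set ℕ} (hB : Monotone B) (u : ℕ) :
    ∃ s, ∀ i, ∀ j < u, j ∈ B i → j ∈ B s := by
  have stage : ∀ j, ∀ᶠ s in atTop, ∀ i, j ∈ B i → j ∈ B s := by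
    intro j
    by_cases hj : ∃ i, j ∈ B i
    · obtain ⟨t, ht⟩ := hj
      exact (eventually_ge_atTop t).mono fun s hs _ _ => hB hs ht
    · exact .of_forall fun s i hi => absurd ⟨i, hi⟩ hj
  obtain ⟨s, hs⟩ := ((eventually_all_finite (Set.finite_Iio u)).2 fun j _ => stage j).exists
  exact ⟨s, fun i j hj => hs j hj i⟩

theorem mem_jump_iUnion_iff {B : ℕ → Set ℕ} (hB : Monotone B) {e : ℕ} :
    e ∈ jump (⋃ i, B i) ↔ ∃ u s, ((ofNat e).eval (restrictBelow (charOracle (B s)) u) e).Dom ∧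
      ∀ i, ∀ j < u, j ∈ B i → j ∈ B s := by
  have restrict_eq : ∀ {u s}, (∀ i, ∀ j < u, j ∈ B i → j ∈ B s) →
      restrictBelow (charOracle (B s)) u = restrictBelow (charOracle (⋃ i, B i)) u := by
    intro u s hs
    refine restrictBelow_congr fun j hj => ?_
    have answer_eq : j ∈ B s ↔ j ∈ ⋃ i, B i :=
      ⟨Set.mem_iUnion_of_mem s, fun h => (Set.mem_iUnion.1 h).elim fun i => hs i j hj⟩
    exact congrArg Part.some (charFn_congr answer_eq)
  refine eval_dom_iff_exists_restrictBelow.trans (exists_congr fun u => ⟨fun h => ?_, ?_⟩)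
  · obtain ⟨s, hs⟩ := exists_forall_lt_mem_of_monotone hB u
    exact ⟨s, by rwa [restrict_eq hs], hs⟩
  · rintro ⟨s, h, hs⟩
    rwa [restrict_eq hs] at h

/-! ### `Σ₂` sets -/

/-- The class `Σ₂` of the arithmetical hierarchy, with a primitive recursive matrix. -/
def IsSigmaTwo (A : Set ℕ) : Prop :=
  ∃ R : ℕ → ℕ → ℕ → Prop, (PrimrecPred fun p : ℕ × ℕ × ℕ => R p.1 p.2.1 p.2.2) ∧
    ∀ e, e ∈ A ↔ ∃ m, ∀ i, R e m i

theorem isSigmaTwo_of_denumerable {α : Type*} [Denumerable α] {A : Set ℕ}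
    {R : ℕ → α → ℕ → Prop} (hR : PrimrecPred fun p : ℕ × α × ℕ => R p.1 p.2.1 p.2.2)
    (hA : ∀ e, e ∈ A ↔ ∃ a, ∀ i, R e a i) : IsSigmaTwo A := by
  refine ⟨fun e m => R e (Denumerable.ofNat α m), ?_, fun e => ?_⟩
  · exact hR.comp (Primrec.fst.pair
      (((Primrec.ofNat α).comp (Primrec.fst.comp .snd)).pair (Primrec.snd.comp .snd)))
  · exact (hA e).trans (Denumerable.eqv α).symm.surjective.exists

theorem exists_primrec_code_eval_eq {α : Type*} [Primcodable α] {g : α → ℕ →. ℕ}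
    (hg : Partrec₂ g) : ∃ b : α → Code, Primrec b ∧ ∀ a, (b a).eval = g a := by
  obtain ⟨c, hc⟩ := Code.exists_code.1 hg
  refine ⟨fun a => c.curry (Encodable.encode a), Code.primrec₂_curry.comp (.const c) .encode,
    fun a => funext fun n => ?_⟩
  rw [Code.eval_curry, hc]
  simp [Part.map_id']

theorem partrec_restrictBelow_enumUpTo (c : Code) :
    Partrec₂ fun q : ℕ × ℕ => restrictBelow (charOracle (enumUpTo c q.2)) q.1 := by
  have lt : PrimrecPred fun p : (ℕ × ℕ) × ℕ => p.2 < p.1.1 :=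
    Primrec.nat_lt.comp .snd (Primrec.fst.comp .fst)
  have mem : PrimrecPred fun p : (ℕ × ℕ) × ℕ => p.2 ∈ enumUpTo c p.1.2 :=
    primrecPred_mem_enumUpTo (.const c) (Primrec.snd.comp .fst) .snd
  refine (Partrec.cond lt.decide.to_comp (computable_charFn mem.computablePred).partrec
    Partrec.none).of_eq fun p => ?_
  by_cases h : p.2 < p.1.1 <;> simp [restrictBelow, h]

theorem isSigmaTwo_jump {A : Set ℕ} (hA : REPred (· ∈ A)) : IsSigmaTwo (jump A) := by
  obtain ⟨c, rfl⟩ := exists_iUnion_enumUpTo_eq hA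
  obtain ⟨b, hb, hb_eval⟩ := exists_primrec_code_eval_eq (partrec_restrictBelow_enumUpTo c)
  refine isSigmaTwo_of_denumerable (α := (ℕ × ℕ) × ℕ) (R := fun e w i =>
    e ∈ enumUpTo (toCode (b w.1) (ofNat e)) w.2 ∧
      ∀ j < w.1.1, j ∈ enumUpTo c i → j ∈ enumUpTo c w.1.2) ?_ fun e => ?_
  · have e : Primrec fun p : ℕ × ((ℕ × ℕ) × ℕ) × ℕ => p.1 := .fst
    have w : Primrec fun p : ℕ × ((ℕ × ℕ) × ℕ) × ℕ => p.2.1 := Primrec.fst.comp .snd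
    have i : Primrec fun p : ℕ × ((ℕ × ℕ) × ℕ) × ℕ => p.2.2 := Primrec.snd.comp .snd
    have q := Primrec.fst.comp w
    have settled : PrimrecRel fun (j : ℕ) (p : ℕ × ℕ) => j ∈ enumUpTo c p.1 → j ∈ enumUpTo c p.2 :=
      ((primrecPred_mem_enumUpTo (.const c) (Primrec.fst.comp .snd) .fst).not.or
        (primrecPred_mem_enumUpTo (.const c) (Primrec.snd.comp .snd) .fst)).of_eq
        fun _ => imp_iff_not_or.symm
    refine (primrecPred_mem_enumUpTo (primrec_toCode_ofNat.comp (hb.comp q) e)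
      (Primrec.snd.comp w) e).and ?_
    exact (settled.forall_mem_list.comp (Primrec.list_range.comp (Primrec.fst.comp q))
      (i.pair (Primrec.snd.comp q))).of_eq fun p => by simp
  · have halts : ∀ q, (∃ k, e ∈ enumUpTo (toCode (b q) (ofNat e)) k) ↔
        ((ofNat e).eval (restrictBelow (charOracle (enumUpTo c q.2)) q.1) e).Dom := by
      intro q
      rw [← Set.mem_iUnion, iUnion_enumUpTo, eval_toCode, hb_eval]
      rfl
    simp only [mem_jump_iUnion_iff (monotone_enumUpTo c), Prod.exists, forall_and, forall_const,
      exists_and_right, halts]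

theorem isSigmaTwo_zeroDoubleJump : IsSigmaTwo zeroDoubleJump :=
  isSigmaTwo_jump (rePred_mem_jump (PrimrecPred.computablePred ⟨fun _ => .isFalse id, .const _⟩))

/-- The least `m` that looks at stage `i` like a witness of `∃ m, ∀ j, R e m j`, that is, the least
`m < i` that satisfies `R e m j` for all `j < i`, or `i` if there is none. -/
noncomputable def leastSurvivor (R : ℕ → ℕ → ℕ → Prop) (e i : ℕ) : ℕ :=
  open Classical in (List.range i).findIdx fun m => decide (∀ j < i, R e m j)

section

variable {R : ℕ → ℕ → ℕ → Prop}

theorem primrec_leastSurvivor (hR : PrimrecPred fun p : ℕ × ℕ × ℕ => R p.1 p.2.1 p.2.2) :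
    Primrec₂ (leastSurvivor R) := by
  classical
  have hR' : PrimrecRel fun (j : ℕ) (q : ℕ × ℕ) => R q.1 q.2 j :=
    hR.comp ((Primrec.fst.comp .snd).pair ((Primrec.snd.comp .snd).pair .fst))
  refine Primrec.list_findIdx (Primrec.list_range.comp .snd) (PrimrecPred.decide ?_)
  exact (hR'.forall_mem_list.comp (Primrec.list_range.comp (Primrec.snd.comp .fst))
    ((Primrec.fst.comp .fst).pair .snd)).of_eq fun p => by simp

theorem leastSurvivor_le {e m : ℕ} (h : ∀ j, R e m j) (i : ℕ) : leastSurvivor R e i ≤ m := by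
  by_contra! hlt
  have := List.not_of_lt_findIdx hlt
  simp [h] at this

theorem eventually_le_leastSurvivor {e m : ℕ} (h : ∀ k < m, ∃ j, ¬ R e k j) :
    ∀ᶠ i in atTop, m ≤ leastSurvivor R e i := by
  have refuted : ∀ᶠ i in atTop, ∀ k < m, ∃ j < i, ¬ R e k j :=
    (eventually_all_finite (Set.finite_Iio m)).2 fun k hk => by
      obtain ⟨j, hj⟩ := h k hk
      exact (eventually_gt_atTop j).mono fun i hi => ⟨j, hi, hj⟩
  filter_upwards [refuted, eventually_gt_atTop m] with i hi hmi
  refine List.le_findIdx_of_not (by simpa using hmi) fun k hk => ?_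
  simpa using hi k hk

end

/-- A primitive recursive approximation of `A` in the limit: `f e i` converges for `i → ∞` if `e`
belongs to `A`, and diverges to infinity otherwise. -/
structure IsLimitTest (f : ℕ → ℕ → ℕ) (A : Set ℕ) : Prop where
  primrec : Primrec₂ f
  exists_eventually_eq : ∀ {e}, e ∈ A → ∃ k, ∀ᶠ i in atTop, f e i = k
  tendsto_atTop : ∀ {e}, e ∉ A → Tendsto (f e) atTop atTop

theorem IsSigmaTwo.exists_isLimitTest {A : Set ℕ} (hA : IsSigmaTwo A) : ∃ f, IsLimitTest f A := by
  classical
  obtain ⟨R, hR, hA⟩ := hA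
  refine ⟨leastSurvivor R, primrec_leastSurvivor hR, fun {e} he => ?_, fun {e} he => ?_⟩
  · have hex := (hA e).1 he
    refine ⟨Nat.find hex, ?_⟩
    filter_upwards [eventually_le_leastSurvivor fun k hk => not_forall.1 (Nat.find_min hex hk)]
      with i hi
    exact (leastSurvivor_le (Nat.find_spec hex) i).antisymm hi
  · refine tendsto_atTop.2 fun m => eventually_le_leastSurvivor fun k _ => ?_
    exact not_forall.1 fun h => he ((hA e).2 ⟨k, h⟩)

/-! ### Coordinates of points and of their names -/

theorem ratVec_apply (l : List RatCode) (j : ℕ) :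
    ratVec l j = ((l.getD j (0, 0, 0)).toRat : ℝ) := by
  simp only [ratVec, lp.coeFn_sum, Finset.sum_apply, lp.single_apply, Pi.single_apply]
  rw [Finset.sum_ite_eq (Finset.range l.length) j]
  split_ifs with h
  · rfl
  · rw [List.getD_eq_default _ _ (by simpa using h)]
    simp [RatCode.toRat]

theorem norm_ratVec_le (l : List RatCode) :
    ‖ratVec l‖ ≤ ∑ j ∈ Finset.range l.length, |ratVec l j| := by
  refine (norm_sum_le _ _).trans_eq (Finset.sum_congr rfl fun j _ => ?_)
  rw [lp.norm_single two_pos, ratVec_apply, Real.norm_eq_abs]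

theorem IsName.abs_sub_le {p : ℕ → List RatCode} {z : Ell2} (hp : IsName p z) (n j : ℕ) :
    |ratVec (p n) j - z j| ≤ (1 / 2) ^ n := by
  have hlim : Tendsto (fun m => ‖ratVec (p n) - ratVec (p m)‖) atTop (𝓝 ‖ratVec (p n) - z‖) :=
    (tendsto_const_nhds.sub hp.2).norm
  calc |ratVec (p n) j - z j|
      ≤ ‖ratVec (p n) - z‖ := lp.norm_apply_le_norm two_ne_zero (ratVec (p n) - z) j
    _ ≤ (1 / 2) ^ n :=
      le_of_tendsto hlim ((eventually_gt_atTop n).mono fun m hm => (hp.1 n m hm).le)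

theorem computableSeq_ratVec {l : ℕ → List RatCode} (hl : Computable l) :
    ComputableSeq fun i => ratVec (l i) :=
  ⟨fun i _ => l i, hl.comp .fst, fun i => ⟨fun n m _ => by simp, tendsto_const_nhds⟩⟩

theorem WeaklyConverges.tendsto_apply {x : ℕ → Ell2} {z : Ell2} (h : WeaklyConverges x z) (j : ℕ) :
    Tendsto (fun i => x i j) atTop (𝓝 (z j)) := by
  simpa [lp.inner_single_left] using h (lp.single 2 j 1)

theorem IsWeakClusterPt.apply_eq_of_tendsto {x : ℕ → Ell2} {z : Ell2} (hz : IsWeakClusterPt x z)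
    {j : ℕ} {a : ℝ} (hx : Tendsto (fun i => x i j) atTop (𝓝 a)) : z j = a := by
  obtain ⟨s, hs, hconv⟩ := hz
  exact tendsto_nhds_unique (hconv.tendsto_apply j) (hx.comp hs.tendsto_atTop)

/-! ### Sequences with moving peaks -/

/-- The `j`-th coordinate of `peakSeq f i`. At `j = ⟨e, k⟩` it codes the rational number `2⁻ᵉ` if
`f e i = k`, and `0` otherwise. -/
def peakEntry (f : ℕ → ℕ → ℕ) (i j : ℕ) : RatCode :=
  if f j.unpair.1 i = j.unpair.2 then (1, 0, 2 ^ j.unpair.1 - 1) else (0, 0, 0)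

/-- The coordinates of `peakSeq f i`, cut off at length `i` to make them a finite sequence. -/
def peakList (f : ℕ → ℕ → ℕ) (i : ℕ) : List RatCode := (List.range i).map (peakEntry f i)

/-- The sequence in `ℓ₂` whose `i`-th member has a peak of height `2⁻ᵉ` at position `f e i` of the
block of coordinates `⟨e, ·⟩`, for every `e` such that `⟨e, f e i⟩ < i`. -/
noncomputable def peakSeq (f : ℕ → ℕ → ℕ) (i : ℕ) : Ell2 := ratVec (peakList f i)

theorem primrec_two_pow : Primrec fun n : ℕ => 2 ^ n :=
  (Primrec₂.unpaired'.1 Nat.Primrec.pow).comp (.const 2) .id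

section

variable {f : ℕ → ℕ → ℕ}

theorem primrec_peakList (hf : Primrec₂ f) : Primrec (peakList f) := by
  refine Primrec.list_map Primrec.list_range ?_
  have e : Primrec fun p : ℕ × ℕ => p.2.unpair.1 := Primrec.fst.comp (Primrec.unpair.comp .snd)
  have k : Primrec fun p : ℕ × ℕ => p.2.unpair.2 := Primrec.snd.comp (Primrec.unpair.comp .snd)
  have two_pow := primrec_two_pow.comp e
  exact Primrec.ite (Primrec.eq.comp (hf.comp e .fst) k)
    ((Primrec.const 1).pair ((Primrec.const 0).pair (Primrec.nat_sub.comp two_pow (.const 1))))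
    (.const _)

theorem toRat_peakEntry (i j : ℕ) :
    (peakEntry f i j).toRat = if f j.unpair.1 i = j.unpair.2 then (1 / 2) ^ j.unpair.1 else 0 := by
  unfold peakEntry
  split_ifs <;> simp [RatCode.toRat, Nat.cast_sub Nat.one_le_two_pow]

theorem peakSeq_apply {i j : ℕ} (hj : j < i) :
    peakSeq f i j = if f j.unpair.1 i = j.unpair.2 then (1 / 2) ^ j.unpair.1 else 0 := by
  have entry : (peakList f i).getD j (0, 0, 0) = peakEntry f i j := by
    simp [peakList, List.getD, hj]
  rw [peakSeq, ratVec_apply, entry, toRat_peakEntry]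
  split_ifs <;> simp

theorem norm_peakSeq_le (i : ℕ) : ‖peakSeq f i‖ ≤ 2 := by
  let peaks := (Finset.range i).filter fun j => f j.unpair.1 i = j.unpair.2
  have one_peak_per_block : Set.InjOn (fun j : ℕ => j.unpair.1) peaks := by
    intro j hj j' hj' h
    have hj := (Finset.mem_filter.1 hj).2
    have hj' := (Finset.mem_filter.1 hj').2
    rw [← Nat.pair_unpair j, ← Nat.pair_unpair j', ← hj, ← hj']
    exact congrArg (fun e => Nat.pair e (f e i)) h
  have blocks_subset : peaks.image (fun j => j.unpair.1) ⊆ Finset.range i := by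
    refine Finset.image_subset_iff.2 fun j hj => Finset.mem_range.2 ?_
    exact (Nat.unpair_left_le j).trans_lt (Finset.mem_range.1 (Finset.mem_filter.1 hj).1)
  calc ‖peakSeq f i‖
      ≤ ∑ j ∈ Finset.range i, |peakSeq f i j| := by
        have length_eq : (peakList f i).length = i := by simp [peakList]
        simpa only [peakSeq, length_eq] using norm_ratVec_le (peakList f i)
    _ = ∑ j ∈ peaks, (1 / 2 : ℝ) ^ j.unpair.1 := by
        rw [Finset.sum_filter]
        refine Finset.sum_congr rfl fun j hj => ?_
        rw [peakSeq_apply (Finset.mem_range.1 hj), abs_of_nonneg (by split_ifs <;> positivity)]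
    _ = ∑ e ∈ peaks.image fun j => j.unpair.1, (1 / 2 : ℝ) ^ e :=
        (Finset.sum_image one_peak_per_block).symm
    _ ≤ ∑ e ∈ Finset.range i, (1 / 2 : ℝ) ^ e :=
        Finset.sum_le_sum_of_subset_of_nonneg blocks_subset fun _ _ _ => by positivity
    _ ≤ 2 := sum_geometric_two_le i

theorem tendsto_peakSeq_apply_of_eventually_eq {e k : ℕ} (h : ∀ᶠ i in atTop, f e i = k) :
    Tendsto (fun i => peakSeq f i (Nat.pair e k)) atTop (𝓝 ((1 / 2) ^ e)) := by
  refine tendsto_const_nhds.congr' ?_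
  filter_upwards [h, eventually_gt_atTop (Nat.pair e k)] with i hi hlt
  simp [peakSeq_apply hlt, hi]

theorem tendsto_peakSeq_apply_of_tendsto_atTop {e : ℕ} (h : Tendsto (f e) atTop atTop) (k : ℕ) :
    Tendsto (fun i => peakSeq f i (Nat.pair e k)) atTop (𝓝 0) := by
  refine tendsto_const_nhds.congr' ?_
  filter_upwards [h.eventually_ne_atTop k, eventually_gt_atTop (Nat.pair e k)] with i hi hlt
  simp [peakSeq_apply hlt, hi]

end

/-! ### Reading off a set from the peaks -/

/-- Some coordinate `⟨e, k⟩` of the finite rational sequence `l` exceeds `2⁻ᵉ / 2`. The bound on `k`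
loses nothing, because `k ≤ ⟨e, k⟩`. -/
def HasPeak (e : ℕ) (l : List RatCode) : Prop :=
  ∃ k < l.length, (1 / 2 : ℚ) ^ (e + 1) < (l.getD (Nat.pair e k) (0, 0, 0)).toRat

theorem hasPeak_iff {e : ℕ} {l : List RatCode} :
    HasPeak e l ↔ ∃ k, (1 / 2 : ℝ) ^ (e + 1) < ratVec l (Nat.pair e k) := by
  have cast : ∀ r : RatCode,
      (1 / 2 : ℝ) ^ (e + 1) < (r.toRat : ℝ) ↔ (1 / 2 : ℚ) ^ (e + 1) < r.toRat := fun r => by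
    rw [← Rat.cast_lt (K := ℝ)]
    push_cast
    rfl
  simp only [HasPeak, ratVec_apply, cast]
  refine ⟨fun ⟨k, _, hk⟩ => ⟨k, hk⟩, fun ⟨k, hk⟩ => ⟨k, ?_, hk⟩⟩
  by_contra! hlen
  rw [List.getD_eq_default _ _ (hlen.trans (Nat.right_le_pair e k))] at hk
  have pow_pos : (0 : ℚ) < (1 / 2) ^ (e + 1) := by positivity
  simp only [RatCode.toRat, Nat.cast_zero, sub_zero, zero_div] at hk
  exact hk.not_gt pow_pos

theorem pow_lt_toRat_iff {n : ℕ} {r : RatCode} :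
    (1 / 2 : ℚ) ^ n < r.toRat ↔ 2 ^ n * r.2.1 + (r.2.2 + 1) < 2 ^ n * r.1 := by
  rw [RatCode.toRat, one_div_pow, div_lt_div_iff₀ (by positivity) (by positivity),
    ← Nat.cast_lt (α := ℚ)]
  push_cast
  constructor <;> intro h <;> linarith

theorem primrecRel_pow_lt_toRat :
    PrimrecRel fun (n : ℕ) (r : RatCode) => (1 / 2 : ℚ) ^ n < r.toRat := by
  have two_pow := primrec_two_pow.comp (Primrec.fst (α := ℕ) (β := RatCode))
  have a : Primrec fun p : ℕ × RatCode => p.2.1 := Primrec.fst.comp .snd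
  have b : Primrec fun p : ℕ × RatCode => p.2.2.1 := Primrec.fst.comp (Primrec.snd.comp .snd)
  have c : Primrec fun p : ℕ × RatCode => p.2.2.2 := Primrec.snd.comp (Primrec.snd.comp .snd)
  exact (Primrec.nat_lt.comp
    (Primrec.nat_add.comp (Primrec.nat_mul.comp two_pow b) (Primrec.succ.comp c))
    (Primrec.nat_mul.comp two_pow a)).of_eq fun _ => pow_lt_toRat_iff.symm

theorem primrecRel_hasPeak : PrimrecRel HasPeak := by
  have e : Primrec fun p : ℕ × ℕ × List RatCode => p.2.1 := Primrec.fst.comp .snd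
  have l : Primrec fun p : ℕ × ℕ × List RatCode => p.2.2 := Primrec.snd.comp .snd
  have coord := (Primrec.list_getD ((0, 0, 0) : RatCode)).comp l (Primrec₂.natPair.comp e .fst)
  have exceeds : PrimrecRel fun (k : ℕ) (q : ℕ × List RatCode) =>
      (1 / 2 : ℚ) ^ (q.1 + 1) < (q.2.getD (Nat.pair q.1 k) (0, 0, 0)).toRat :=
    primrecRel_pow_lt_toRat.comp (Primrec.succ.comp e) coord
  exact (exceeds.exists_mem_list.comp (Primrec.list_range.comp (Primrec.list_length.comp .snd))
    .id).of_eq fun p => by simp [HasPeak]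

theorem IsLimitTest.mem_iff_hasPeak {f : ℕ → ℕ → ℕ} {A : Set ℕ} (hf : IsLimitTest f A) {z : Ell2}
    (hz : IsWeakClusterPt (peakSeq f) z) {p : ℕ → List RatCode} (hp : IsName p z) (e : ℕ) :
    e ∈ A ↔ HasPeak e (p (e + 2)) := by
  have half : (1 / 2 : ℝ) ^ (e + 1) = (1 / 2) ^ e / 2 := by ring
  have quarter : (1 / 2 : ℝ) ^ (e + 2) = (1 / 2) ^ e / 4 := by ring
  have pow_pos : (0 : ℝ) < (1 / 2) ^ e := by positivity
  have close := fun k => abs_le.1 (hp.abs_sub_le (e + 2) (Nat.pair e k))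
  rw [hasPeak_iff]
  constructor
  · intro he
    obtain ⟨k, hk⟩ := hf.exists_eventually_eq he
    have peak := hz.apply_eq_of_tendsto (tendsto_peakSeq_apply_of_eventually_eq hk)
    exact ⟨k, by linarith [close k]⟩
  · rintro ⟨k, hk⟩
    by_contra he
    have flat := hz.apply_eq_of_tendsto
      (tendsto_peakSeq_apply_of_tendsto_atTop (hf.tendsto_atTop he) k)
    linarith [close k]

theorem turingReducible_of_computable₂ {σ : Type*} [Primcodable σ] {F : ℕ → σ → ℕ}
    (hF : Computable₂ F) {q : ℕ → ℕ} (hq : Computable q) (p : ℕ → σ) :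
    TuringReducible (fun n => Part.some (F n (p (q n))))
      (fun n => Part.some (Encodable.encode (p n))) := by
  refine RecursiveIn.iff_nat.2 ?_
  have answer := Nat.RecursiveIn.comp (Nat.RecursiveIn.oracle
    (O := {fun n => Part.some (Encodable.encode (p n))}) _ rfl)
    (Partrec.nat_iff.1 hq.partrec).recursiveIn
  have input := (Partrec.nat_iff.1 Computable.id.partrec).recursiveIn
    (O := {fun n => Part.some (Encodable.encode (p n))})
  refine (Nat.RecursiveIn.comp (Nat.Partrec.recursiveIn hF)
    (Nat.RecursiveIn.pair input answer)).of_eq fun n => ?_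
  simp [Seq.seq]

theorem pointComputes_of_computablePred {z : Ell2} {A : Set ℕ} {T : ℕ → List RatCode → Prop}
    (hT : ComputablePred fun a : ℕ × List RatCode => T a.1 a.2) {q : ℕ → ℕ} (hq : Computable q)
    (h : ∀ p, IsName p z → ∀ e, e ∈ A ↔ T e (p (q e))) : PointComputes z A := by
  intro p hp
  have test : Computable₂ fun e l => charFn {n | T n l} e := computable_charFn hT
  have charFn_eq : ∀ e, charFn A e = charFn {n | T n (p (q e))} e :=
    fun e => charFn_congr (h p hp e)
  simpa only [charFn_eq] using turingReducible_of_computable₂ test hq p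

end WeakBW

theorem mainTheorem4_general {A : Set ℕ} (hA : WeakBW.IsSigmaTwo A) :
    ∃ x : ℕ → WeakBW.Ell2,
      WeakBW.ComputableSeq x ∧
      (∃ C : ℝ, ∀ i, ‖x i‖ ≤ C) ∧
      ∀ z : WeakBW.Ell2, WeakBW.IsWeakClusterPt x z → WeakBW.PointComputes z A := by
  obtain ⟨f, hf⟩ := hA.exists_isLimitTest
  refine ⟨WeakBW.peakSeq f,
    WeakBW.computableSeq_ratVec (WeakBW.primrec_peakList hf.primrec).to_comp,
    ⟨2, WeakBW.norm_peakSeq_le⟩, fun z hz => ?_⟩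
  exact WeakBW.pointComputes_of_computablePred WeakBW.primrecRel_hasPeak.computablePred
    (Primrec.nat_add.comp .id (.const 2)).to_comp fun p hp => hf.mem_iff_hasPeak hz hp

theorem mainTheorem4 :
    ∃ x : ℕ → WeakBW.Ell2,
      WeakBW.ComputableSeq x ∧
      (∃ C : ℝ, ∀ i, ‖x i‖ ≤ C) ∧
      ∀ z : WeakBW.Ell2, WeakBW.IsWeakClusterPt x z →
        WeakBW.PointComputes z WeakBW.zeroDoubleJump :=
  mainTheorem4_general WeakBW.isSigmaTwo_zeroDoubleJump
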